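/- A *box* in $\mathbb{R}^d$ is a set $[\alpha_1,\beta_1]\times\dots\times[\alpha_d,\beta_d]$ with $\alpha_j\le\beta_j$ for all $j$. A family of subsets of $\mathbb{R}^d$ is *$n$-pierceable* if there is a set of at most $n$ points of $\mathbb{R}^d$ that meets every member of the family. Given families $\mathcal F_1,\dots,\mathcal F_m$, a *colorful $t$-tuple* is a tuple $(C_1,\dots,C_t)$ whose members are taken from $t$ distinct families, that is, $C_j\in\mathcal F_{i_j}$ with $i_1,\dots,i_t$ pairwise distinct. Let $H_c(d,n)$ be the least positive integer $m$ with the following property: whenever $\mathcal F_1,\dots,\mathcal F_m$ are non-empty finite families of boxes in $\mathbb{R}^d$ such that every colorful $m$-tuple is $n$-pierceable, there exist $i\in\{1,\dots,m\}$ and, for each $k\ne i$, a box $F_k\in\mathcal F_k$ such that the extended family $\mathcal F_i\cup\{F_k : k\neq i\}$ is $n$-pierceable. **Theorem.** (1) For every integer $n\ge 0$, $H_c(1,n)$ exists and equals $n+1$. (2) For every integer $d\ge 1$, $H_c(d,2)$ exists and equals $3d$. (3) For every integer $d\ge 1$ there are $3d-1$ families of boxes in $\mathbb{R}^d$, each consisting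 of exactly three pairwise disjoint boxes (so that none of the families is $2$-pierceable), such that every colorful $(3d-1)$-tuple is $2$-pierceable. -/

import Mathlib

/-- A (closed, nonempty) axis-parallel box `[a₁, b₁] × ⋯ × [a_d, b_d]` in `ℝ^d`. The order on
`Fin d → ℝ` is the coordinatewise one, so `Set.Icc a b` is the product of the intervals. -/
def IsAxisBox {d : ℕ} (B : Set (Fin d → ℝ)) : Prop :=
  ∃ a b : Fin d → ℝ, a ≤ b ∧ B = Set.Icc a b

/-- A family `𝓕` of subsets of `X` is `n`-pierceable if some set of at most `n` points of `X` meets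
every member of `𝓕`. -/
def Pierceable {X : Type*} (n : ℕ) (𝓕 : Set (Set X)) : Prop :=
  ∃ A : Finset X, A.card ≤ n ∧ ∀ B ∈ 𝓕, (B ∩ (A : Set X)).Nonempty

/-- `C` is a colorful `t`-tuple from the families `F 0, …, F (m - 1)`: its members are taken from
pairwise different families. -/
def IsColorfulTuple {X : Type*} {m t : ℕ} (F : Fin m → Set (Set X)) (C : Fin t → Set X) : Prop :=
  ∃ σ : Fin t → Fin m, Function.Injective σ ∧ ∀ j, C j ∈ F (σ j)

/-- Every colorful `t`-tuple from the families `F` is `n`-pierceable. -/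
def ColorfulTuplesPierceable {X : Type*} {m : ℕ} (t n : ℕ) (F : Fin m → Set (Set X)) : Prop :=
  ∀ C : Fin t → Set X, IsColorfulTuple F C → Pierceable n (Set.range C)

/-- Some family `F i`, extended by one suitable member of each other family, is `n`-pierceable. -/
def ExtendedFamilyPierceable {X : Type*} {m : ℕ} (n : ℕ) (F : Fin m → Set (Set X)) : Prop :=
  ∃ i : Fin m, ∃ G : Fin m → Set X,
    (∀ k, k ≠ i → G k ∈ F k) ∧ Pierceable n (F i ∪ {B | ∃ k, k ≠ i ∧ B = G k})

/-- The strong colorful Helly property for `n`-piercing `m` families of boxes in `ℝ^d`: for all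
nonempty finite families `F 0, …, F (m - 1)` of axis-parallel boxes, if every colorful `m`-tuple is
`n`-pierceable, then some `F i` together with one member of each other family is `n`-pierceable. -/
def StrongColorfulHelly (d n m : ℕ) : Prop :=
  ∀ F : Fin m → Set (Set (Fin d → ℝ)),
    (∀ k, (F k).Nonempty) → (∀ k, (F k).Finite) → (∀ k, ∀ B ∈ F k, IsAxisBox B) →
    ColorfulTuplesPierceable m n F → ExtendedFamilyPierceable n F

/-- `h` is the colorful Helly number `H_c(d, n)`: the least positive integer with the strong
colorful Helly property. (That such an integer exists is part of the assertion.) -/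
def IsStrongColorfulHellyNumber (d n h : ℕ) : Prop :=
  IsLeast {m : ℕ | 0 < m ∧ StrongColorfulHelly d n m} h

/-!
Three arguments carry the theorem.

**Intervals** (`exists_extended_pierceable_of_intervals`). Let `I`, of colour `i`, have the least
right end `r` among all intervals of all families. If some other family is pierced by `r` alone,
then `r` pierces this family and `I`, and one further point for each of the remaining colours
suffices. Otherwise restrict the other families to the intervals to the right of `r`: a piercing
set of a colorful tuple together with `I` spends a point on `I` that meets none of the restricted
intervals, so induction on `n` applies, and `r` is added to the piercing set it gives.

**Boxes, two points, upper bound** (`exists_extended_pierceable_two`). Greedily choose boxes of at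
most `2 * d` colours such that, in each coordinate `j`, one chosen box has the least upper end `l j`
and one chosen box has the greatest lower end `r j` among the chosen boxes and all boxes of unused
colours (`exists_extremal_choice`); one box may serve several purposes. If the chosen boxes, together
with further boxes of unused colours, are pierced by two points, these points may be pushed into
opposite corners of the box spanned by `l` and `r`. A pair of opposite corners is described by a sign
vector in `Bool ^ d`, and the sign vectors whose corners pierce a given box are a subset closed
under complement and under the sum of three elements, that is, an affine subspace over the field
with two elements. Each unused colour containing a box that rules out a surviving sign vector
reduces the survivors to at most half. Survivors always exist, by the hypothesis on colorful tuples, and they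
come in complementary pairs, so at most `d - 1` halvings occur and an unused colour remains. Every
survivor then pierces the extended family of that colour.

**Lower bound** (`pierceable_two_tightBox`). For each coordinate `j` take one family of three parallel
slabs on the negative side and one of three on the positive side; for consecutive coordinates take
a family of three disjoint boxes `x j < 0`, `x j > 0 > x (j + 1)`, `x j > 0, x (j + 1) > 0`. The latter
impose on the sign vector at most a relation between its entries at `j` and `j + 1`, and such relations
along a path can always be satisfied.
-/

/-! ### Piercing numbers -/

theorem Pierceable.mono {X : Type*} {n : ℕ} {𝓕 𝓖 : Set (Set X)} (h : 𝓕 ⊆ 𝓖)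
    (hp : Pierceable n 𝓖) : Pierceable n 𝓕 :=
  let ⟨A, hA, hm⟩ := hp
  ⟨A, hA, fun B hB => hm B (h hB)⟩

theorem not_pierceable_of_pairwise_disjoint {X : Type*} {n : ℕ} {𝓕 : Set (Set X)}
    (B : Fin (n + 1) → Set X) (hB : ∀ c c', c ≠ c' → Disjoint (B c) (B c'))
    (hF : ∀ c, B c ∈ 𝓕) : ¬ Pierceable n 𝓕 := by
  rintro ⟨A, hA, hm⟩
  choose x hx using fun c => hm (B c) (hF c)
  have hinj : Function.Injective x := fun c c' h => by
    by_contra hne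
    exact Set.disjoint_left.1 (hB c c' hne) (hx c).1 (h ▸ (hx c').1)
  have := Finset.card_le_card_of_injOn x (s := Finset.univ) (t := A)
    (fun c _ => (hx c).2) hinj.injOn
  simp at this
  omega

theorem pierceable_range_of_le {X : Type*} {m n : ℕ} (h : m ≤ n) (C : Fin m → Set X)
    (hC : ∀ j, (C j).Nonempty) : Pierceable n (Set.range C) := by
  classical
  choose x hx using hC
  refine ⟨Finset.univ.image x, Finset.card_image_le.trans (by simpa using h), ?_⟩
  rintro _ ⟨j, rfl⟩
  exact ⟨x j, hx j, by simp⟩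

theorem ExtendedFamilyPierceable.exists_pierceable {X : Type*} {m n : ℕ}
    {F : Fin m → Set (Set X)} (h : ExtendedFamilyPierceable n F) : ∃ i, Pierceable n (F i) :=
  let ⟨i, _, _, hp⟩ := h
  ⟨i, hp.mono Set.subset_union_left⟩

theorem IsAxisBox.nonempty {d : ℕ} {B : Set (Fin d → ℝ)} (h : IsAxisBox B) : B.Nonempty := by
  obtain ⟨a, b, hab, rfl⟩ := h
  exact Set.nonempty_Icc.2 hab

/-! ### Intervals on the line -/

/-- The greedy induction for intervals, for the families with colours in a finite set `K`. The
functions `lo` and `hi` give the ends of the intervals. -/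
theorem exists_extended_pierceable_of_intervals {ι : Type*} [DecidableEq ι]
    (lo hi : Set (Fin 1 → ℝ) → ℝ) (n : ℕ) :
    ∀ (K : Finset ι) (F : ι → Set (Set (Fin 1 → ℝ))), K.card = n + 1 →
    (∀ k ∈ K, (F k).Nonempty) → (∀ k ∈ K, (F k).Finite) →
    (∀ k ∈ K, ∀ B ∈ F k, lo B ≤ hi B ∧ ∀ x, x ∈ B ↔ lo B ≤ x 0 ∧ x 0 ≤ hi B) →
    (∀ g : ι → Set (Fin 1 → ℝ), (∀ k ∈ K, g k ∈ F k) → Pierceable n (g '' K)) →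
    ∃ i ∈ K, ∃ g : ι → Set (Fin 1 → ℝ), (∀ k ∈ K, g k ∈ F k) ∧ Pierceable n (F i ∪ g '' K) := by
  classical
  induction n with
  | zero =>
    intro K F hK hne _ _ hcol
    choose! g hg using hne
    obtain ⟨k, hk⟩ := Finset.card_pos.1 (by omega : 0 < K.card)
    obtain ⟨A, hA, hm⟩ := hcol g hg
    obtain ⟨x, _, hx⟩ := hm (g k) (Set.mem_image_of_mem g hk)
    have hA0 : A = ∅ := Finset.card_eq_zero.1 (by omega)
    simp [hA0] at hx
  | succ n ih =>
    intro K F hK hne hfin hbox hcol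
    obtain ⟨I, hI, hmin⟩ : ∃ I ∈ ⋃ k ∈ K, F k, ∀ B ∈ ⋃ k ∈ K, F k, hi I ≤ hi B := by
      refine Set.exists_min_image _ hi (K.finite_toSet.biUnion fun k hk => hfin k hk) ?_
      obtain ⟨k, hk⟩ := Finset.card_pos.1 (by omega : 0 < K.card)
      obtain ⟨B, hB⟩ := hne k hk
      exact ⟨B, Set.mem_biUnion hk hB⟩
    simp only [Set.mem_iUnion, exists_prop] at hI hmin
    obtain ⟨i, hiK, hIi⟩ := hI
    have hKi : (K.erase i).card = n + 1 := by rw [Finset.card_erase_of_mem hiK]; omega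
    -- The point `hi I` pierces every interval that does not lie strictly to its right.
    have hpierce : ∀ k ∈ K, ∀ B ∈ F k, ¬ hi I < lo B → (fun _ => hi I : Fin 1 → ℝ) ∈ B :=
      fun k hk B hB h => ((hbox k hk B hB).2 _).2 ⟨not_lt.1 h, hmin B ⟨k, hk, hB⟩⟩
    have hII : (fun _ => hi I : Fin 1 → ℝ) ∈ I :=
      hpierce i hiK I hIi (not_lt.2 (hbox i hiK I hIi).1)
    by_cases hcase : ∃ k ∈ K.erase i, ∀ B ∈ F k, ¬ hi I < lo B
    · obtain ⟨k, hk, hkI⟩ := hcase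
      have hkK := Finset.mem_of_mem_erase hk
      choose! g hg using hne
      have hg' : ∀ l ∈ K, Function.update g i I l ∈ F l := by
        intro l hl
        by_cases hli : l = i
        · subst hli; simpa using hIi
        · simpa [hli] using hg l hl
      refine ⟨k, hkK, Function.update g i I, hg',
        insert (fun _ => hi I) (((K.erase i).erase k).image fun l _ => lo (g l)), ?_, ?_⟩
      · refine (Finset.card_insert_le _ _).trans (Nat.succ_le_succ (Finset.card_image_le.trans ?_))
        rw [Finset.card_erase_of_mem hk]
        omega
      · rintro B (hB | ⟨l, hl, rfl⟩)
        · exact ⟨_, hpierce k hkK B hB (hkI B hB), by simp⟩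
        · by_cases hli : l = i
          · subst hli
            exact ⟨_, by simpa using hII, by simp⟩
          · rw [Function.update_of_ne hli]
            by_cases hlk : l = k
            · subst hlk
              exact ⟨_, hpierce l hl _ (hg l hl) (hkI _ (hg l hl)), by simp⟩
            · refine ⟨fun _ => lo (g l), ((hbox l hl _ (hg l hl)).2 _).2
                ⟨le_rfl, (hbox l hl _ (hg l hl)).1⟩, ?_⟩
              rw [Finset.mem_coe]
              exact Finset.mem_insert_of_mem (Finset.mem_image.2
                ⟨l, Finset.mem_erase.2 ⟨hlk, Finset.mem_erase.2 ⟨hli, hl⟩⟩, rfl⟩)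
    · push Not at hcase
      obtain ⟨k, hk, g, hg, A, hA, hm⟩ := ih (K.erase i) (fun k => {B ∈ F k | hi I < lo B}) hKi
        hcase
        (fun k hk => (hfin k (Finset.mem_of_mem_erase hk)).subset fun B hB => hB.1)
        (fun k hk B hB => hbox k (Finset.mem_of_mem_erase hk) B hB.1) (by
          intro g hg
          obtain ⟨A, hA, hm⟩ := hcol (Function.update g i I) (by
            intro l hl
            by_cases hli : l = i
            · subst hli; simpa using hIi
            · simpa [hli] using (hg l (Finset.mem_erase.2 ⟨hli, hl⟩)).1)
          obtain ⟨a, haI, haA⟩ := hm I ⟨i, hiK, by simp⟩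
          -- The point spent on `I` lies to the left of all members of the restricted families.
          refine ⟨A.erase a, ?_, ?_⟩
          · rw [Finset.card_erase_of_mem haA]; omega
          · rintro _ ⟨l, hl, rfl⟩
            have hl' := Finset.mem_erase.1 hl
            obtain ⟨x, hx, hxA⟩ := hm (g l) ⟨l, hl'.2, by simp [hl'.1]⟩
            refine ⟨x, hx, Finset.mem_coe.2 (Finset.mem_erase.2 ⟨?_, hxA⟩)⟩
            rintro rfl
            have h1 := (((hbox i hiK I hIi).2 _).1 haI).2
            have h2 := (((hbox l hl'.2 _ (hg l hl).1).2 _).1 hx).1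
            have h3 := (hg l hl).2
            linarith)
      have hkK := Finset.mem_of_mem_erase hk
      refine ⟨k, hkK, Function.update g i I, ?_, insert (fun _ => hi I) A,
        (Finset.card_insert_le _ _).trans (by omega), ?_⟩
      · intro l hl
        by_cases hli : l = i
        · subst hli; simpa using hIi
        · simpa [hli] using (hg l (Finset.mem_erase.2 ⟨hli, hl⟩)).1
      · have hsub : ∀ B, (B ∩ (A : Set (Fin 1 → ℝ))).Nonempty →
            (B ∩ ((insert (fun _ => hi I) A : Finset (Fin 1 → ℝ)) : Set (Fin 1 → ℝ))).Nonempty :=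
          fun B ⟨x, hx, hxA⟩ => ⟨x, hx, by simp [Finset.mem_coe.1 hxA]⟩
        rintro B (hB | ⟨l, hl, rfl⟩)
        · by_cases hBI : hi I < lo B
          · exact hsub B (hm B (Or.inl ⟨hB, hBI⟩))
          · exact ⟨_, hpierce k hkK B hB hBI, by simp⟩
        · by_cases hli : l = i
          · subst hli
            exact ⟨_, by simpa using hII, by simp⟩
          · rw [Function.update_of_ne hli]
            exact hsub _ (hm _ (Or.inr ⟨l, Finset.mem_erase.2 ⟨hli, hl⟩, rfl⟩))

theorem strongColorfulHelly_one (n : ℕ) : StrongColorfulHelly 1 n (n + 1) := by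
  intro F hne hfin hbox hcol
  choose! lo hi hle heq using
    (fun B h => h : ∀ B : Set (Fin 1 → ℝ), IsAxisBox B → ∃ a b, a ≤ b ∧ B = Set.Icc a b)
  obtain ⟨i, -, g, hg, hp⟩ := exists_extended_pierceable_of_intervals
    (fun B => lo B 0) (fun B => hi B 0) n Finset.univ F (by simp) (fun k _ => hne k)
    (fun k _ => hfin k)
    (fun k _ B hB => ⟨hle B (hbox k B hB) 0, fun x => by
      conv_lhs => rw [heq B (hbox k B hB)]
      simp [Set.mem_Icc, Pi.le_def]⟩)
    (fun g hg => by
      simpa using hcol g ⟨id, Function.injective_id, fun j => hg j (Finset.mem_univ j)⟩)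
  refine ⟨i, g, fun k _ => hg k (Finset.mem_univ k), hp.mono (Set.union_subset_union_right _ ?_)⟩
  rintro B ⟨k, -, rfl⟩
  exact ⟨k, by simp, rfl⟩

/-- Families of `n + 1` distinct points: any `n` of them are trivially `n`-pierceable. -/
theorem not_strongColorfulHelly_one {m n : ℕ} (h : m ≤ n) : ¬ StrongColorfulHelly 1 n m := by
  intro hs
  have hbox : ∀ c : Fin (n + 1),
      IsAxisBox (Set.Icc (fun _ => (c : ℝ)) (fun _ => (c : ℝ)) : Set (Fin 1 → ℝ)) :=
    fun c => ⟨_, _, le_rfl, rfl⟩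
  obtain ⟨i, hp⟩ := (hs (fun _ => Set.range fun c : Fin (n + 1) =>
      (Set.Icc (fun _ => (c : ℝ)) (fun _ => (c : ℝ)) : Set (Fin 1 → ℝ)))
    (fun _ => Set.range_nonempty _) (fun _ => Set.finite_range _)
    (by rintro k _ ⟨c, rfl⟩; exact hbox c)
    (by
      rintro C ⟨σ, -, hC⟩
      refine pierceable_range_of_le h C fun j => ?_
      obtain ⟨c, hc⟩ := hC j
      exact hc ▸ (hbox c).nonempty)).exists_pierceable
  refine not_pierceable_of_pairwise_disjoint
    (fun c : Fin (n + 1) => Set.Icc (fun _ => (c : ℝ)) (fun _ => (c : ℝ)))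
    (fun c c' hcc => ?_) (fun c => Set.mem_range_self c) hp
  rw [Set.disjoint_left]
  intro x hx hx'
  simp only [Set.Icc_self, Set.mem_singleton_iff] at hx hx'
  have : (c : ℝ) = c' := congrFun (hx.symm.trans hx') 0
  exact hcc (Fin.ext (by exact_mod_cast this))

/-! ### Greedy choice of extremal members -/

/-- Given finitely many real-valued functions `f p`, `p ∈ R`, on the members of finite families,
at most one colour per function can be fixed, with one member `g k` of each fixed colour `k`, such
that each `f p` is minimized by a fixed member among the fixed members and all members of the
colours that are not fixed. -/
theorem exists_extremal_choice {ι ρ α : Type*} [Fintype ι] [Nonempty ι] [DecidableEq ι]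
    (F : ι → Set α) (hne : ∀ k, (F k).Nonempty) (hfin : ∀ k, (F k).Finite) (f : ρ → α → ℝ)
    (R : Finset ρ) :
    ∃ (U : Finset ι) (g : ι → α), U.card ≤ R.card ∧ (∀ k, g k ∈ F k) ∧
      ∀ p ∈ R, ∃ k ∈ U, ∀ k', ∀ B ∈ F k', (k' ∈ U → B = g k') → f p (g k) ≤ f p B := by
  classical
  induction R using Finset.induction_on with
  | empty =>
    choose g hg using hne
    exact ⟨∅, g, le_rfl, hg, by simp⟩
  | insert p R hp ih =>
    obtain ⟨U, g, hU, hg, hmin⟩ := ih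
    obtain ⟨⟨k₀, B₀⟩, ⟨hB₀, hB₀U⟩, hm⟩ := Set.exists_min_image
      {q : ι × α | q.2 ∈ F q.1 ∧ (q.1 ∈ U → q.2 = g q.1)} (fun q => f p q.2)
      (by
        have : (⋃ k, Prod.mk k '' F k).Finite :=
          Set.finite_iUnion fun k => (hfin k).image _
        refine this.subset ?_
        rintro ⟨k, B⟩ ⟨hB, -⟩
        exact Set.mem_iUnion.2 ⟨k, B, hB, rfl⟩)
      ⟨(Classical.arbitrary ι, g _), hg _, fun _ => rfl⟩
    simp only at hB₀ hB₀U
    have hsame : ∀ k ∈ U, Function.update g k₀ B₀ k = g k := by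
      intro k hk
      by_cases h : k = k₀
      · subst h; simpa using hB₀U hk
      · simp [h]
    have hpool : ∀ (k : ι) (B : α),
        (k ∈ insert k₀ U → B = Function.update g k₀ B₀ k) → k ∈ U → B = g k :=
      fun k B h hk => (h (Finset.mem_insert_of_mem hk)).trans (hsame k hk)
    refine ⟨insert k₀ U, Function.update g k₀ B₀, ?_, ?_, ?_⟩
    · rw [Finset.card_insert_of_notMem hp]
      exact (Finset.card_insert_le _ _).trans (by omega)
    · intro k
      by_cases h : k = k₀
      · subst h; simpa using hB₀
      · simpa [h] using hg k
    · intro q hq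
      rcases Finset.mem_insert.1 hq with rfl | hq
      · refine ⟨k₀, Finset.mem_insert_self _ _, fun k B hB h => ?_⟩
        simpa using hm (k, B) ⟨hB, hpool k B h⟩
      · obtain ⟨k, hk, hkm⟩ := hmin q hq
        refine ⟨k, Finset.mem_insert_of_mem hk, fun k' B hB h => ?_⟩
        rw [hsame k hk]
        exact hkm k' B hB (hpool k' B h)

/-! ### Affine sets of sign vectors -/

/-- The sum of three sign vectors, modulo two. -/
def xorThree {d : ℕ} (s t u : Fin d → Bool) : Fin d → Bool :=
  fun j => xor (s j) (xor (t j) (u j))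

/-- The set `S` of sign vectors is a (possibly empty) affine subspace over the field with two
elements. -/
def ClosedUnderXorThree {d : ℕ} (S : Finset (Fin d → Bool)) : Prop :=
  ∀ s ∈ S, ∀ t ∈ S, ∀ u ∈ S, xorThree s t u ∈ S

/-- A proper nonempty affine subspace has at most half as many elements. -/
theorem two_mul_card_le_of_ssubset {d : ℕ} {S T : Finset (Fin d → Bool)} (hTS : T ⊂ S)
    (hS : ClosedUnderXorThree S) (hT : ClosedUnderXorThree T) (hne : T.Nonempty) :
    2 * T.card ≤ S.card := by
  classical
  obtain ⟨s, hs⟩ := hne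
  have hsub := hTS.1
  obtain ⟨u, hu, huT⟩ := (Finset.ssubset_iff_of_subset hsub).1 hTS
  -- Translation by `s + u` maps `T` into its complement in `S`.
  have hcard : T.card ≤ (S \ T).card := by
    refine Finset.card_le_card_of_injOn (fun t => xorThree t s u) (fun t ht => ?_) ?_
    · have ht : t ∈ T := ht
      refine Finset.mem_coe.2 (Finset.mem_sdiff.2 ⟨hS t (hsub ht) s (hsub hs) u hu, fun h => huT ?_⟩)
      have := hT _ h t ht s hs
      convert this using 1
      funext j
      simp only [xorThree]
      cases t j <;> cases s j <;> cases u j <;> rfl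
    · intro t _ t' _ h
      funext j
      have := congrFun h j
      simp only [xorThree] at this
      revert this
      cases t j <;> cases t' j <;> cases s j <;> cases u j <;> simp
  have := Finset.card_sdiff_add_card_eq_card hsub
  omega

/-- The sign vectors `s` such that `s` or its complement lies in the product set with factors
`P j`. -/
def PairMeets {d : ℕ} (P : Fin d → Bool → Prop) (s : Fin d → Bool) : Prop :=
  (∀ j, P j (s j)) ∨ ∀ j, P j (!s j)

theorem PairMeets.compl {d : ℕ} {P : Fin d → Bool → Prop} {s : Fin d → Bool}
    (h : PairMeets P s) : PairMeets P fun j => !s j := by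
  rcases h with h | h
  · exact Or.inr fun j => by simpa using h j
  · exact Or.inl h

/-- The sum of three bits equals one of them, so product sets are closed under sums of three
sign vectors; complementing a summand complements the sum. -/
theorem PairMeets.xorThree {d : ℕ} {P : Fin d → Bool → Prop} {s t u : Fin d → Bool}
    (hs : PairMeets P s) (ht : PairMeets P t) (hu : PairMeets P u) :
    PairMeets P (xorThree s t u) := by
  have key : ∀ a b c e : Bool, e = xor a (xor b c) →
      ∀ Q : Bool → Prop, Q a → Q b → Q c → Q e := by
    rintro a b c _ rfl Q ha hb hc
    cases a <;> cases b <;> cases c <;> assumption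
  rcases hs with hs | hs <;> rcases ht with ht | ht <;> rcases hu with hu | hu
  · exact Or.inl fun j => key _ _ _ _ (by simp [_root_.xorThree]) (P j) (hs j) (ht j) (hu j)
  · exact Or.inr fun j => key _ _ _ _ (by simp [_root_.xorThree]) (P j) (hs j) (ht j) (hu j)
  · exact Or.inr fun j => key _ _ _ _ (by simp [_root_.xorThree]) (P j) (hs j) (ht j) (hu j)
  · exact Or.inl fun j => key _ _ _ _ (by simp [_root_.xorThree]) (P j) (hs j) (ht j) (hu j)
  · exact Or.inr fun j => key _ _ _ _ (by simp [_root_.xorThree]) (P j) (hs j) (ht j) (hu j)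
  · exact Or.inl fun j => key _ _ _ _ (by simp [_root_.xorThree]) (P j) (hs j) (ht j) (hu j)
  · exact Or.inl fun j => key _ _ _ _ (by simp [_root_.xorThree]) (P j) (hs j) (ht j) (hu j)
  · exact Or.inr fun j => key _ _ _ _ (by simp [_root_.xorThree]) (P j) (hs j) (ht j) (hu j)

/-! ### Two points in opposite corners -/

/-- The corner with coordinates `r j` where `s j` is true and `l j` where it is false. -/
def corner {d : ℕ} (l r : Fin d → ℝ) (s : Fin d → Bool) : Fin d → ℝ :=
  fun j => if s j then r j else l j

/-- The `j`-th coordinate of a corner, `r j` if `e` is true and `l j` otherwise, lies in the `j`-th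
side of the box `Icc a b`. -/
def SideContains {d : ℕ} (l r a b : Fin d → ℝ) (j : Fin d) (e : Bool) : Prop :=
  a j ≤ (if e then r j else l j) ∧ (if e then r j else l j) ≤ b j

theorem corner_mem_Icc {d : ℕ} {l r a b : Fin d → ℝ} {s : Fin d → Bool} :
    corner l r s ∈ Set.Icc a b ↔ ∀ j, SideContains l r a b j (s j) := by
  simp only [Set.mem_Icc, Pi.le_def, corner, SideContains, forall_and]

/-- Two points that are separated by `l j < r j` in each coordinate `j` where this inequality holds
can be pushed into a pair of opposite corners without leaving any box that reaches up to `l` and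
down to `r`. -/
theorem exists_pairMeets_of_separated {d : ℕ} {l r p q : Fin d → ℝ}
    (h : ∀ j, r j ≤ l j ∨ (p j ≤ l j ∧ r j ≤ q j) ∨ (q j ≤ l j ∧ r j ≤ p j)) :
    ∃ s : Fin d → Bool, ∀ a b : Fin d → ℝ, l ≤ b → a ≤ r →
      (p ∈ Set.Icc a b ∨ q ∈ Set.Icc a b) → PairMeets (SideContains l r a b) s := by
  have h' : ∀ j, ∃ e : Bool, r j ≤ l j ∨ (e = false ∧ p j ≤ l j ∧ r j ≤ q j) ∨
      (e = true ∧ q j ≤ l j ∧ r j ≤ p j) := by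
    intro j
    rcases h j with h | h | h
    · exact ⟨false, Or.inl h⟩
    · exact ⟨false, Or.inr (Or.inl ⟨rfl, h⟩)⟩
    · exact ⟨true, Or.inr (Or.inr ⟨rfl, h⟩)⟩
  choose s hs using h'
  refine ⟨s, fun a b hb ha hpq => ?_⟩
  rcases hpq with hp | hq
  · refine Or.inl fun j => ?_
    have h1 := hp.1 j
    have h2 := hp.2 j
    have h3 := hb j
    have h4 := ha j
    rcases hs j with h | ⟨h, h5, h6⟩ | ⟨h, h5, h6⟩
    · cases s j <;> simp only [SideContains] <;> constructor <;> simp <;> linarith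
    all_goals
      rw [h]
      simp only [SideContains]
      constructor <;> simp <;> linarith
  · refine Or.inr fun j => ?_
    have h1 := hq.1 j
    have h2 := hq.2 j
    have h3 := hb j
    have h4 := ha j
    rcases hs j with h | ⟨h, h5, h6⟩ | ⟨h, h5, h6⟩
    · cases s j <;> simp only [SideContains] <;> constructor <;> simp <;> linarith
    all_goals
      rw [h]
      simp only [SideContains]
      constructor <;> simp <;> linarith

theorem exists_pair_of_card_le_two {X : Type*} [Nonempty X] (A : Finset X) (hA : A.card ≤ 2) :
    ∃ p q, ∀ x ∈ A, x = p ∨ x = q := by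
  classical
  interval_cases h : A.card
  · rw [Finset.card_eq_zero] at h
    exact ⟨Classical.arbitrary X, Classical.arbitrary X, by simp [h]⟩
  · obtain ⟨p, rfl⟩ := Finset.card_eq_one.1 h
    exact ⟨p, p, by simp⟩
  · obtain ⟨p, q, -, rfl⟩ := Finset.card_eq_two.1 h
    exact ⟨p, q, by simp⟩

/-! ### The upper bound for two points -/

/-- The upper bound for families indexed by any type of `3 * d` colours. The chosen member of the
colour `i` itself is harmless, as it lies in `F i` anyway. -/
theorem exists_extended_pierceable_two {ι : Type*} [Fintype ι] {d : ℕ} (hd : 1 ≤ d)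
    (hι : Fintype.card ι = 3 * d) (F : ι → Set (Set (Fin d → ℝ)))
    (hne : ∀ k, (F k).Nonempty) (hfin : ∀ k, (F k).Finite) (hbox : ∀ k, ∀ B ∈ F k, IsAxisBox B)
    (hcol : ∀ g : ι → Set (Fin d → ℝ), (∀ k, g k ∈ F k) → Pierceable 2 (Set.range g)) :
    ∃ i, ∃ g : ι → Set (Fin d → ℝ), (∀ k, g k ∈ F k) ∧ Pierceable 2 (F i ∪ Set.range g) := by
  classical
  have : Nonempty ι := Fintype.card_pos_iff.1 (by omega)
  choose! lo hi hle heq using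
    (fun B h => h : ∀ B : Set (Fin d → ℝ), IsAxisBox B → ∃ a b, a ≤ b ∧ B = Set.Icc a b)
  obtain ⟨U, g, hU, hg, hext⟩ := exists_extremal_choice F hne hfin
    (fun (p : Fin d × Bool) B => if p.2 then - lo B p.1 else hi B p.1) Finset.univ
  replace hU : U.card ≤ 2 * d := by simpa [mul_comm] using hU
  choose kl hklU hkl using fun j => hext (j, false) (Finset.mem_univ _)
  choose kr hkrU hkr using fun j => hext (j, true) (Finset.mem_univ _)
  set l : Fin d → ℝ := fun j => hi (g (kl j)) j
  set r : Fin d → ℝ := fun j => lo (g (kr j)) j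
  have hhi : ∀ k, ∀ B ∈ F k, (k ∈ U → B = g k) → l ≤ hi B :=
    fun k B hB h j => by simpa using hkl j k B hB h
  have hlo : ∀ k, ∀ B ∈ F k, (k ∈ U → B = g k) → lo B ≤ r :=
    fun k B hB h j => by simpa using hkr j k B hB h
  let Sol : Set (Fin d → ℝ) → (Fin d → Bool) → Prop :=
    fun B => PairMeets (SideContains l r (lo B) (hi B))
  -- Colorful tuples that extend the extremal choice are pierced by a pair of opposite corners.
  have hsol : ∀ g' : ι → Set (Fin d → ℝ), (∀ k, g' k ∈ F k) → (∀ k ∈ U, g' k = g k) →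
      ∃ s, ∀ k, Sol (g' k) s := by
    intro g' hg' hgU
    obtain ⟨A, hA, hm⟩ := hcol g' hg'
    obtain ⟨p, q, hpq⟩ := exists_pair_of_card_le_two A hA
    have hmeet : ∀ k, p ∈ Set.Icc (lo (g' k)) (hi (g' k)) ∨ q ∈ Set.Icc (lo (g' k)) (hi (g' k)) := by
      intro k
      rw [← heq _ (hbox k _ (hg' k))]
      obtain ⟨x, hx, hxA⟩ := hm (g' k) ⟨k, rfl⟩
      rcases hpq x hxA with rfl | rfl
      · exact Or.inl hx
      · exact Or.inr hx
    obtain ⟨s, hs⟩ := exists_pairMeets_of_separated (l := l) (r := r) (p := p) (q := q) (by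
      intro j
      have h1 := hmeet (kl j)
      have h2 := hmeet (kr j)
      rw [hgU _ (hklU j)] at h1
      rw [hgU _ (hkrU j)] at h2
      rcases h1 with h1 | h1 <;> rcases h2 with h2 | h2
      · exact Or.inl ((h2.1 j).trans (h1.2 j))
      · exact Or.inr (Or.inl ⟨h1.2 j, h2.1 j⟩)
      · exact Or.inr (Or.inr ⟨h1.2 j, h2.1 j⟩)
      · exact Or.inl ((h2.1 j).trans (h1.2 j)))
    exact ⟨s, fun k => hs _ _ (hhi k _ (hg' k) (hgU k)) (hlo k _ (hg' k) (hgU k)) (hmeet k)⟩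
  let S : Finset ι → (ι → Set (Fin d → ℝ)) → Finset (Fin d → Bool) :=
    fun V g' => Finset.univ.filter fun s => ∀ k ∈ V, Sol (g' k) s
  have hSmem : ∀ V g' s, s ∈ S V g' ↔ ∀ k ∈ V, Sol (g' k) s := fun V g' s => by simp [S]
  have hSxor : ∀ V g', ClosedUnderXorThree (S V g') := by
    intro V g' s hs t ht u hu
    rw [hSmem] at *
    exact fun k hk => (hs k hk).xorThree (ht k hk) (hu k hk)
  have hSne : ∀ V g', (∀ k, g' k ∈ F k) → (∀ k ∈ U, g' k = g k) → (S V g').Nonempty := by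
    intro V g' hg' hgU
    obtain ⟨s, hs⟩ := hsol g' hg' hgU
    exact ⟨s, (hSmem _ _ _).2 fun k _ => hs k⟩
  -- A maximal set `V` of colours with at most `2 ^ (3 * d - V.card)` survivors.
  obtain ⟨V, ⟨hUV, g', hg', hgU, hcard⟩, hmax⟩ := (Set.toFinite {V : Finset ι | U ⊆ V ∧
      ∃ g' : ι → Set (Fin d → ℝ), (∀ k, g' k ∈ F k) ∧ (∀ k ∈ U, g' k = g k) ∧
        (S V g').card * 2 ^ V.card ≤ 2 ^ (3 * d)}).exists_maximal ⟨U, subset_rfl, g, hg,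
          fun _ _ => rfl, by
            calc (S U g).card * 2 ^ U.card ≤ 2 ^ d * 2 ^ (2 * d) :=
                  Nat.mul_le_mul ((Finset.card_le_univ _).trans (by simp))
                    (Nat.pow_le_pow_right (by norm_num) hU)
              _ = 2 ^ (3 * d) := by rw [← pow_add]; congr 1; ring⟩
  obtain ⟨s, hs⟩ := hSne V g' hg' hgU
  -- Survivors come in complementary pairs.
  have htwo : 2 ≤ (S V g').card := by
    refine Finset.one_lt_card.2 ⟨s, hs, fun j => !s j, ?_, fun h => ?_⟩
    · rw [hSmem] at hs ⊢
      exact fun k hk => (hs k hk).compl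
    · have := congrFun h ⟨0, hd⟩
      simp at this
  have hVcard : V.card < 3 * d := by
    have h1 : 2 ^ (V.card + 1) ≤ 2 ^ (3 * d) := by
      rw [pow_succ, mul_comm]
      exact (Nat.mul_le_mul_right _ htwo).trans hcard
    have := (Nat.pow_le_pow_iff_right (by norm_num : 1 < 2)).1 h1
    omega
  obtain ⟨i, hi'⟩ : ∃ i, i ∉ V := by
    by_contra! hall
    rw [Finset.eq_univ_of_forall hall, Finset.card_univ, hι] at hVcard
    exact lt_irrefl _ hVcard
  have hrest : ∀ k, k ∉ V → ∀ B ∈ F k, Sol B s := by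
    intro k hk B hB
    by_contra hns
    have hkU : k ∉ U := fun h => hk (hUV h)
    have hg'' : ∀ k', Function.update g' k B k' ∈ F k' := by
      intro k'
      by_cases h : k' = k
      · subst h; simpa using hB
      · simpa [h] using hg' k'
    have hgU' : ∀ k' ∈ U, Function.update g' k B k' = g k' := by
      intro k' hk'
      have h : k' ≠ k := fun h => hkU (h ▸ hk')
      simpa [h] using hgU k' hk'
    have hss : S (insert k V) (Function.update g' k B) ⊂ S V g' := by
      refine Finset.ssubset_iff_of_subset (fun t ht => ?_) |>.2 ⟨s, hs, fun h => ?_⟩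
      · rw [hSmem] at ht ⊢
        intro k' hk'
        have h : k' ≠ k := fun h => hk (h ▸ hk')
        simpa [h] using ht k' (Finset.mem_insert_of_mem hk')
      · rw [hSmem] at h
        exact hns (by simpa using h k (Finset.mem_insert_self _ _))
    have hhalf := two_mul_card_le_of_ssubset hss (hSxor _ _) (hSxor _ _) (hSne _ _ hg'' hgU')
    refine hk (hmax (y := insert k V) ⟨hUV.trans (Finset.subset_insert _ _), _, hg'', hgU', ?_⟩
      (Finset.subset_insert _ _) (Finset.mem_insert_self _ _))
    rw [Finset.card_insert_of_notMem hk, pow_succ]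
    calc _ = 2 * (S (insert k V) (Function.update g' k B)).card * 2 ^ V.card := by ring
      _ ≤ _ := (Nat.mul_le_mul_right _ hhalf).trans hcard
  have hpierce : ∀ k, ∀ B ∈ F k, Sol B s → (B ∩ (({corner l r s, corner l r fun j => !s j} :
      Finset (Fin d → ℝ)) : Set (Fin d → ℝ))).Nonempty := by
    intro k B hB h
    have hBeq := heq B (hbox k B hB)
    rcases h with h | h
    · exact ⟨corner l r s, by rw [hBeq]; exact corner_mem_Icc.2 h, by simp⟩
    · exact ⟨corner l r fun j => !s j, by rw [hBeq]; exact corner_mem_Icc.2 h, by simp⟩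
  refine ⟨i, g', hg', {corner l r s, corner l r fun j => !s j}, Finset.card_le_two, ?_⟩
  rintro B (hB | ⟨k, rfl⟩)
  · exact hpierce i B hB (hrest i hi' B hB)
  · by_cases hk : k ∈ V
    · exact hpierce k _ (hg' k) ((hSmem _ _ _).1 hs k hk)
    · exact hpierce k _ (hg' k) (hrest k hk _ (hg' k))

theorem strongColorfulHelly_two {d : ℕ} (hd : 1 ≤ d) : StrongColorfulHelly d 2 (3 * d) := by
  intro F hne hfin hbox hcol
  obtain ⟨i, g, hg, hp⟩ := exists_extended_pierceable_two hd (by simp) F hne hfin hbox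
    fun g hg => hcol g ⟨id, Function.injective_id, hg⟩
  refine ⟨i, g, fun k _ => hg k, hp.mono (Set.union_subset_union_right _ ?_)⟩
  rintro B ⟨k, -, rfl⟩
  exact ⟨k, rfl⟩

/-! ### The lower bound for two points -/

/-- Lower ends of the boxes `tightBox d k c`. -/
def tightLo (k : ℕ) (c : Fin 3) (j : ℕ) : ℝ :=
  if k = 3 * j then -((c : ℕ) + 1) else
  if k = 3 * j + 1 then (c : ℕ) + 1 else
  if k = 3 * j + 2 then (if c = 0 then -3 else 1) else
  if k + 1 = 3 * j then (if c = 2 then 1 else -3) else -3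

/-- Upper ends of the boxes `tightBox d k c`. -/
def tightHi (k : ℕ) (c : Fin 3) (j : ℕ) : ℝ :=
  if k = 3 * j then -((c : ℕ) + 1) else
  if k = 3 * j + 1 then (c : ℕ) + 1 else
  if k = 3 * j + 2 then (if c = 0 then -1 else 3) else
  if k + 1 = 3 * j then (if c = 1 then -1 else 3) else 3

/-- The boxes of the extremal families inside `[-3, 3] ^ d`, where `k` is the colour and `c` numbers
the three boxes of a colour. The colours `3 * j` and `3 * j + 1` consist of the slabs `x j = -(c + 1)`
and `x j = c + 1`, and the colour `3 * j + 2` consists of the boxes `x j ≤ -1`,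
`x j ≥ 1, x (j + 1) ≤ -1` and `x j ≥ 1, x (j + 1) ≥ 1`. -/
def tightBox (d k : ℕ) (c : Fin 3) : Set (Fin d → ℝ) :=
  Set.Icc (fun j => tightLo k c j) (fun j => tightHi k c j)

theorem tightLo_le_tightHi (k : ℕ) (c : Fin 3) (j : ℕ) : tightLo k c j ≤ tightHi k c j := by
  unfold tightLo tightHi
  fin_cases c <;> split_ifs <;> simp_all

theorem isAxisBox_tightBox (d k : ℕ) (c : Fin 3) : IsAxisBox (tightBox d k c) :=
  ⟨_, _, fun j => tightLo_le_tightHi k c j, rfl⟩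

theorem disjoint_tightBox {d k : ℕ} (hk : k < 3 * d - 1) {c c' : Fin 3} (hc : c ≠ c') :
    Disjoint (tightBox d k c) (tightBox d k c') := by
  wlog h : c < c' generalizing c c'
  · exact (this hc.symm (lt_of_le_of_ne (not_lt.1 h) hc.symm)).symm
  rw [Set.disjoint_left]
  rintro x ⟨h1, h2⟩ ⟨h3, h4⟩
  have hj : k / 3 < d := by omega
  have a1 := h1 ⟨k / 3, hj⟩
  have a2 := h2 ⟨k / 3, hj⟩
  have a3 := h3 ⟨k / 3, hj⟩
  have a4 := h4 ⟨k / 3, hj⟩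
  obtain hk0 | hk1 | hk2 : k = 3 * (k / 3) ∨ k = 3 * (k / 3) + 1 ∨ k = 3 * (k / 3) + 2 := by omega
  · have hcc : ((c : ℕ) : ℝ) < ((c' : ℕ) : ℝ) := by exact_mod_cast h
    simp only [tightLo, tightHi, if_pos hk0] at a1 a2 a3 a4
    linarith
  · have hcc : ((c : ℕ) : ℝ) < ((c' : ℕ) : ℝ) := by exact_mod_cast h
    have n0 : k ≠ 3 * (k / 3) := by omega
    simp only [tightLo, tightHi, if_neg n0, if_pos hk1] at a1 a2 a3 a4
    linarith
  · have n0 : k ≠ 3 * (k / 3) := by omega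
    have n1 : k ≠ 3 * (k / 3) + 1 := by omega
    simp only [tightLo, tightHi, if_neg n0, if_neg n1, if_pos hk2] at a1 a2 a3 a4
    have hj' : k / 3 + 1 < d := by omega
    have b2 := h2 ⟨k / 3 + 1, hj'⟩
    have b3 := h3 ⟨k / 3 + 1, hj'⟩
    have m0 : k ≠ 3 * (k / 3 + 1) := by omega
    have m1 : k ≠ 3 * (k / 3 + 1) + 1 := by omega
    have m2 : k ≠ 3 * (k / 3 + 1) + 2 := by omega
    have m3 : k + 1 = 3 * (k / 3 + 1) := by omega
    simp only [tightLo, tightHi, if_neg m0, if_neg m1, if_neg m2, if_pos m3] at b2 b3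
    -- The first box is separated from the others at `j`, the other two from each other at `j + 1`.
    fin_cases c <;> fin_cases c' <;> simp at h a1 a2 a3 a4 b2 b3 <;> linarith

/-- A sign vector compatible with the boxes of the colours `3 * j + 2` chosen by `c`: only the
choice of the box with `x j` and `x (j + 1)` of different signs requires a change of sign. -/
def pathSign (c : ℕ → Fin 3) : ℕ → Bool
  | 0 => false
  | j + 1 => if c (3 * j + 2) = 1 then !pathSign c j else pathSign c j

/-- The point on the slabs chosen by `c`, on the positive slab of coordinate `j` if `s j` is true
and on the negative slab otherwise. -/
def slabPoint (d : ℕ) (c : ℕ → Fin 3) (s : ℕ → Bool) : Fin d → ℝ :=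
  fun j => if s j then (c (3 * j + 1) : ℕ) + 1 else -((c (3 * j) : ℕ) + 1)

theorem slabPoint_bounds {d : ℕ} (c : ℕ → Fin 3) (s : ℕ → Bool) (j : Fin d) :
    (s j = true → 1 ≤ slabPoint d c s j ∧ slabPoint d c s j ≤ 3) ∧
    (s j = false → -3 ≤ slabPoint d c s j ∧ slabPoint d c s j ≤ -1) := by
  have h : ∀ e : Fin 3, (0 : ℝ) ≤ (e : ℕ) ∧ ((e : ℕ) : ℝ) ≤ 2 := fun e =>
    ⟨by positivity, by exact_mod_cast (by omega : (e : ℕ) ≤ 2)⟩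
  have h1 := h (c (3 * j + 1))
  have h2 := h (c (3 * j))
  constructor <;> intro hs <;> simp only [slabPoint, hs] <;> constructor <;> simp <;> linarith

/-- The condition on the signs at coordinates `j` and `j + 1` for the point `slabPoint d c s` to lie
in the chosen box of colour `k`. -/
theorem slabPoint_mem_tightBox {d k : ℕ} {c : ℕ → Fin 3} {s : ℕ → Bool}
    (h0 : ∀ j, k = 3 * j → s j = false) (h1 : ∀ j, k = 3 * j + 1 → s j = true)
    (h2 : ∀ j, k = 3 * j + 2 → (c k = 0 → s j = false) ∧ (c k ≠ 0 → s j = true) ∧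
      (c k = 1 → s (j + 1) = false) ∧ (c k = 2 → s (j + 1) = true)) :
    slabPoint d c s ∈ tightBox d k (c k) := by
  have key : ∀ j : Fin d, tightLo k (c k) j ≤ slabPoint d c s j ∧
      slabPoint d c s j ≤ tightHi k (c k) j := by
    intro j
    have hb := slabPoint_bounds c s j
    have hwide : -3 ≤ slabPoint d c s j ∧ slabPoint d c s j ≤ 3 := by
      cases hs : s j
      · have := hb.2 hs
        constructor <;> linarith
      · have := hb.1 hs
        constructor <;> linarith
    by_cases e0 : k = 3 * j
    · have hs := h0 j e0
      simp [tightLo, tightHi, slabPoint, hs, ← e0]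
    by_cases e1 : k = 3 * j + 1
    · have hs := h1 j e1
      simp only [tightLo, tightHi, if_neg e0, slabPoint, hs, ← e1]
      simp
    by_cases e2 : k = 3 * j + 2
    · obtain ⟨ha, hb', -, -⟩ := h2 j e2
      simp only [tightLo, tightHi, if_neg e0, if_neg e1, if_pos e2]
      by_cases hc : c k = 0
      · simpa [hc] using hb.2 (ha hc)
      · simpa [hc] using hb.1 (hb' hc)
    by_cases e3 : k + 1 = 3 * j
    · have hj : (j : ℕ) - 1 + 1 = j := by omega
      obtain ⟨-, -, ha, hb'⟩ := h2 (j - 1) (by omega)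
      rw [hj] at ha hb'
      simp only [tightLo, tightHi, if_neg e0, if_neg e1, if_neg e2, if_pos e3]
      by_cases hc : c k = 1
      · simpa [hc] using hb.2 (ha hc)
      · by_cases hc' : c k = 2
        · simpa [hc'] using hb.1 (hb' hc')
        · simpa [hc, hc'] using hwide
    · simpa only [tightLo, tightHi, if_neg e0, if_neg e1, if_neg e2, if_neg e3] using hwide
  exact ⟨fun j => (key j).1, fun j => (key j).2⟩

/-- One box of each colour: the points given by the compatible sign vector and its complement
pierce all of them. -/
theorem pierceable_two_tightBox (d : ℕ) (c : ℕ → Fin 3) :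
    Pierceable 2 (Set.range fun k => tightBox d k (c k)) := by
  classical
  refine ⟨{slabPoint d c (pathSign c), slabPoint d c fun j => !pathSign c j},
    Finset.card_le_two, ?_⟩
  rintro _ ⟨k, rfl⟩
  suffices h : slabPoint d c (pathSign c) ∈ tightBox d k (c k) ∨
      slabPoint d c (fun j => !pathSign c j) ∈ tightBox d k (c k) by
    rcases h with h | h
    · exact ⟨_, h, by simp⟩
    · exact ⟨_, h, by simp⟩
  have hpath : ∀ j, pathSign c (j + 1) =
      if c (3 * j + 2) = 1 then !pathSign c j else pathSign c j := fun j => rfl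
  obtain ⟨i, hk | hk | hk⟩ : ∃ i, k = 3 * i ∨ k = 3 * i + 1 ∨ k = 3 * i + 2 :=
    ⟨k / 3, by omega⟩
  all_goals
    have hi : ∀ j, (k = 3 * j ∨ k = 3 * j + 1 ∨ k = 3 * j + 2) → j = i := fun j hj => by omega
  · cases hs : pathSign c i
    · left
      refine slabPoint_mem_tightBox (fun j hj => ?_) (fun j hj => ?_) (fun j hj => ?_)
      · rw [hi j (by omega), hs]
      all_goals omega
    · right
      refine slabPoint_mem_tightBox (fun j hj => ?_) (fun j hj => ?_) (fun j hj => ?_)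
      · simp [hi j (by omega), hs]
      all_goals omega
  · cases hs : pathSign c i
    · right
      refine slabPoint_mem_tightBox (fun j hj => ?_) (fun j hj => ?_) (fun j hj => ?_)
      · omega
      · simp [hi j (by omega), hs]
      · omega
    · left
      refine slabPoint_mem_tightBox (fun j hj => ?_) (fun j hj => ?_) (fun j hj => ?_)
      · omega
      · rw [hi j (by omega), hs]
      · omega
  · have hp := hpath i
    rw [← hk] at hp
    have hpos : ∀ (e : Fin 3) (b : Bool), (b = false ↔ e = 0) →
        (e = 0 → b = false) ∧ (e ≠ 0 → b = true) ∧
        (e = 1 → (if e = 1 then !b else b) = false) ∧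
        (e = 2 → (if e = 1 then !b else b) = true) := by decide
    have hneg : ∀ (e : Fin 3) (b : Bool), ¬ (b = false ↔ e = 0) →
        (e = 0 → (!b) = false) ∧ (e ≠ 0 → (!b) = true) ∧
        (e = 1 → (!(if e = 1 then !b else b)) = false) ∧
        (e = 2 → (!(if e = 1 then !b else b)) = true) := by decide
    -- The first box is pierced on the side where the sign at `i` is negative, the others on the
    -- side where it is positive.
    by_cases hside : (pathSign c i = false ↔ c k = 0)
    · left
      refine slabPoint_mem_tightBox (fun j hj => by omega) (fun j hj => by omega) (fun j hj => ?_)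
      rw [hi j (by omega), hp]
      exact hpos _ _ hside
    · right
      refine slabPoint_mem_tightBox (fun j hj => by omega) (fun j hj => by omega) (fun j hj => ?_)
      rw [hi j (by omega), hp]
      exact hneg _ _ hside

theorem colorfulTuplesPierceable_tightBox (d m : ℕ) :
    ColorfulTuplesPierceable m 2 fun k : Fin m => Set.range (tightBox d k) := by
  rintro C ⟨σ, hσ, hC⟩
  choose γ hγ using hC
  have hinj : Function.Injective fun j => (σ j : ℕ) := Fin.val_injective.comp hσ
  refine (pierceable_two_tightBox d (Function.extend (fun j => (σ j : ℕ)) γ 0)).mono ?_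
  rintro _ ⟨j, rfl⟩
  refine ⟨σ j, ?_⟩
  have := hinj.extend_apply γ 0 j
  simp only at this ⊢
  rw [this]
  exact hγ j

theorem not_pierceable_tightBox {d k : ℕ} (hk : k < 3 * d - 1) :
    ¬ Pierceable 2 (Set.range (tightBox d k)) :=
  not_pierceable_of_pairwise_disjoint (tightBox d k) (fun _ _ h => disjoint_tightBox hk h)
    fun c => ⟨c, rfl⟩

theorem tightBox_injective {d k : ℕ} (hk : k < 3 * d - 1) :
    Function.Injective (tightBox d k) := by
  intro c c' h
  by_contra hc
  have hdis := disjoint_tightBox hk hc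
  rw [← h, disjoint_self] at hdis
  exact (isAxisBox_tightBox d k c).nonempty.ne_empty hdis

theorem not_strongColorfulHelly_two {d m : ℕ} (hm : m < 3 * d) :
    ¬ StrongColorfulHelly d 2 m := by
  intro hs
  obtain ⟨i, hp⟩ := (hs (fun k => Set.range (tightBox d k)) (fun _ => Set.range_nonempty _)
    (fun _ => Set.finite_range _) (by rintro k _ ⟨c, rfl⟩; exact isAxisBox_tightBox d k c)
    (colorfulTuplesPierceable_tightBox d m)).exists_pierceable
  exact not_pierceable_tightBox (by omega) hp

theorem mainTheorem1 :
    (∀ n : ℕ, IsStrongColorfulHellyNumber 1 n (n + 1)) ∧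
    (∀ d : ℕ, 1 ≤ d → IsStrongColorfulHellyNumber d 2 (3 * d)) ∧
    (∀ d : ℕ, 1 ≤ d → ∃ F : Fin (3 * d - 1) → Set (Set (Fin d → ℝ)),
      (∀ k, ∀ B ∈ F k, IsAxisBox B) ∧
      (∀ k, (F k).ncard = 3 ∧ (F k).PairwiseDisjoint id) ∧
      (∀ k, ¬ Pierceable 2 (F k)) ∧
      ColorfulTuplesPierceable (3 * d - 1) 2 F) := by
  refine ⟨fun n => ⟨⟨n.succ_pos, strongColorfulHelly_one n⟩, fun m hm => ?_⟩,
    fun d hd => ⟨⟨by omega, strongColorfulHelly_two hd⟩, fun m hm => ?_⟩,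
    fun d _ => ⟨fun k => Set.range (tightBox d k), ?_, fun k => ⟨?_, ?_⟩,
      fun k => not_pierceable_tightBox k.2, colorfulTuplesPierceable_tightBox d _⟩⟩
  · by_contra h
    exact not_strongColorfulHelly_one (by omega) hm.2
  · by_contra h
    exact not_strongColorfulHelly_two (by omega) hm.2
  · rintro k _ ⟨c, rfl⟩
    exact isAxisBox_tightBox d k c
  · change (Set.range (tightBox d k)).ncard = 3
    rw [← Set.image_univ, Set.ncard_image_of_injective _ (tightBox_injective k.2)]
    simp
  · rintro _ ⟨c, rfl⟩ _ ⟨c', rfl⟩ h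
    exact disjoint_tightBox k.2 fun hc => h (by rw [hc])
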